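/- Let $\mathbb D$ be the open unit disk, let $H^2$ be the Hardy space of $\mathbb D$ (the holomorphic functions on $\mathbb D$ with square-summable Taylor coefficients, with the $\ell^2$ inner product of the coefficients), and let $S$ be the shift $(Sf)(z)=zf(z)$ on $H^2$. Let $b$ be a holomorphic function on $\mathbb D$ with $|b|\le 1$, and let $a\in H^\infty$ be an outer function with $a(0)>0$ such that, for the boundary values, $|a|^2+|b|^2=1$ almost everywhere on $\partial\mathbb D$ (so $b$ is not an extreme point of the unit ball of $H^\infty$). For $\lambda\in\partial\mathbb D$ let $\mu_\lambda$ be the finite positive Borel measure on $\partial\mathbb D$ whose Poisson integral is the real part of $\frac{1+\overline\lambda b}{1-\overline\lambda b}$, and put $F_\lambda=\frac{a}{1-\overline\lambda b}$. Assume that $z_0\in\partial\mathbb D$ and that $\lambda\in\partial\mathbb D$ is such that $\mu_\lambda$ is absolutely continuous with respect to Lebesgue measure. Then $F_\lambda\in H^2$, and for the bounded operator $$A_\lambda=S^*-F_\lambda(0)^{-1}\,(S^*F_\lambda\otimes 1)\quad\text{on } H^2,\qquad (u\otimes v)h=\langle h,v\rangle u,$$ and every integer $k\ge 0$, $$\dim\ker(A_\lambda-\overline{z_0})^k=k\iff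 F_\lambda(z)\,(1-\overline{z_0}z)^{-k}\in H^2 .$$ -/

import Mathlib

open MeasureTheory Filter Topology
open scoped ComplexConjugate ENNReal

noncomputable section

/-- The Hardy space `H²` of the unit disk, as a Hilbert space: the power series
`f(z) = ∑ f n * z ^ n` with square-summable coefficients, with the inner product of `ℓ²`.
The holomorphic function on the disk is `HardyTwo.eval f`. -/
abbrev HardyTwo : Type := lp (fun _ : ℕ => ℂ) 2

namespace HardyTwo

/-- The value at `z` (in the unit disk) of an element of `H²`. -/
def eval (f : HardyTwo) (z : ℂ) : ℂ := ∑' n, f n * z ^ n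

/-- The constant function `1`. -/
def one : HardyTwo := lp.single 2 0 1

/-- Taylor coefficients of `z * f(z)`. -/
def shiftFun (f : ℕ → ℂ) : ℕ → ℂ
  | 0 => 0
  | n + 1 => f n

theorem hasSum_shiftFun (f : HardyTwo) :
    HasSum (fun n => ‖shiftFun f n‖ ^ 2) (‖f‖ ^ 2) := by
  have h := lp.hasSum_norm (p := 2) (by norm_num) f
  have h2 : HasSum (fun n => ‖f n‖ ^ 2) (‖f‖ ^ 2) := by
    simpa using h
  rw [← hasSum_nat_add_iff' 1]
  simpa [shiftFun] using h2

theorem memℓp_shiftFun (f : HardyTwo) :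
    Memℓp (E := fun _ : ℕ => ℂ) (shiftFun f) 2 := by
  refine memℓp_gen ?_
  simpa using (hasSum_shiftFun f).summable

/-- The unilateral shift `S` on `H²`, multiplication by `z`. -/
def shift : HardyTwo →L[ℂ] HardyTwo :=
  LinearMap.mkContinuous
    { toFun := fun f => ⟨shiftFun f, memℓp_shiftFun f⟩
      map_add' := fun f g => by
        ext n
        cases n
        · exact (add_zero (0 : ℂ)).symm
        · rfl
      map_smul' := fun c f => by
        ext n
        cases n
        · exact (mul_zero c).symm
        · rfl }
    1
    (fun f => by
      have h := lp.hasSum_norm (p := 2) (by norm_num)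
        (⟨shiftFun f, memℓp_shiftFun f⟩ : HardyTwo)
      have h2 : ‖(⟨shiftFun f, memℓp_shiftFun f⟩ : HardyTwo)‖ ^ 2 = ‖f‖ ^ 2 :=
        HasSum.unique (by simpa using h) (hasSum_shiftFun f)
      have h3 := (sq_eq_sq₀ (norm_nonneg _) (norm_nonneg _)).1 h2
      simpa using h3.le)

theorem shift_apply_zero (f : HardyTwo) : shift f 0 = 0 := rfl

theorem shift_apply_succ (f : HardyTwo) (n : ℕ) : shift f (n + 1) = f n := rfl

/-- The backward shift `S*`. -/
def backwardShift : HardyTwo →L[ℂ] HardyTwo := ContinuousLinearMap.adjoint shift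

/-- The operator `S* - F(0)⁻¹ (S*F ⊗ 1)` on `H²`, where `(u ⊗ v) h = ⟨h, v⟩ u`
(with the inner product linear in the first variable; Mathlib's is linear in the second). -/
def opA (F : HardyTwo) : HardyTwo →L[ℂ] HardyTwo :=
  backwardShift - (F.eval 0)⁻¹ • InnerProductSpace.rankOne ℂ (backwardShift F) one

end HardyTwo

/-- The function `g`, on the open unit disk, belongs to `H²`. -/
def MemHardyTwo (g : ℂ → ℂ) : Prop :=
  ∃ h : HardyTwo, ∀ z ∈ Metric.ball (0 : ℂ) 1, h.eval z = g z

/-- The Borel σ-algebra of the unit circle. -/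
instance instMeasurableSpaceUnitCircle : MeasurableSpace Circle := borel Circle

instance instBorelSpaceUnitCircle : BorelSpace Circle := ⟨rfl⟩

/-- Normalized Lebesgue measure on the unit circle. -/
def circleLebesgue : Measure Circle :=
  (ENNReal.ofReal (2 * Real.pi))⁻¹ •
    Measure.map Circle.exp (volume.restrict (Set.Ioc 0 (2 * Real.pi)))

/-- `w` is the radial limit of `g` at the point `ζ` of the unit circle. -/
def HasRadialLimit (g : ℂ → ℂ) (ζ : Circle) (w : ℂ) : Prop :=
  Tendsto (fun r : ℝ => g (r * ζ)) (𝓝[<] 1) (𝓝 w)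

/-- `g` is an outer function on the unit disk:
`g(z) = c exp ∫ (ζ + z) / (ζ - z) u(ζ) dm(ζ)` with `|c| = 1` and `u` real, integrable
(so that `u = log |g|` almost everywhere on the circle). -/
def IsOuter (g : ℂ → ℂ) : Prop :=
  ∃ (c : Circle) (u : Circle → ℝ), Integrable u circleLebesgue ∧
    ∀ z ∈ Metric.ball (0 : ℂ) 1,
      g z = c * Complex.exp (∫ ζ : Circle, herglotzRieszKernel 0 z ζ * u ζ ∂circleLebesgue)

/-- `(b, a)` is a pair: `b` is in the closed unit ball of `H^∞`, `a` is an outer function in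
`H^∞` with `a(0) > 0`, and `|a|² + |b|² = 1` almost everywhere on the unit circle, for the
radial boundary values. -/
structure IsPair (b a : ℂ → ℂ) : Prop where
  differentiableOn_b : DifferentiableOn ℂ b (Metric.ball 0 1)
  norm_b_le : ∀ z ∈ Metric.ball (0 : ℂ) 1, ‖b z‖ ≤ 1
  differentiableOn_a : DifferentiableOn ℂ a (Metric.ball 0 1)
  bounded_a : ∃ C : ℝ, ∀ z ∈ Metric.ball (0 : ℂ) 1, ‖a z‖ ≤ C
  outer_a : IsOuter a
  re_a_zero_pos : 0 < (a 0).re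
  im_a_zero : (a 0).im = 0
  sq_add_sq : ∀ᵐ ζ ∂circleLebesgue, ∃ α β : ℂ,
    HasRadialLimit a ζ α ∧ HasRadialLimit b ζ β ∧ ‖α‖ ^ 2 + ‖β‖ ^ 2 = 1

/-- `μ` is the measure `μ_λ` of `b`: the finite positive Borel measure on the unit circle whose
Poisson integral is the real part of `(1 + conj λ * b) / (1 - conj λ * b)`. -/
structure IsClarkMeasure (b : ℂ → ℂ) (lam : Circle) (μ : Measure Circle) : Prop where
  finite : IsFiniteMeasure μ
  poisson : ∀ z ∈ Metric.ball (0 : ℂ) 1,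
    ∫ ζ : Circle, poissonKernel 0 z ζ ∂μ =
      ((1 + conj (lam : ℂ) * b z) / (1 - conj (lam : ℂ) * b z)).re

/-- The function `F_λ = a / (1 - conj λ * b)`. -/
def clarkF (b a : ℂ → ℂ) (lam : Circle) (z : ℂ) : ℂ :=
  a z / (1 - conj (lam : ℂ) * b z)

end

/-! Write `w` for the conjugate of `z₀`. Division by `F` turns `opA F` into the backward shift on
formal power series: `z · A f = f - (f(0)/F(0)) F`, so `A f / F` is `f / F` with its constant term
dropped. Hence `(A - w)^k f = 0` exactly when `(1 - w z)^k f / F` is a polynomial `p` of degree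
below `k`, that is, `f = p F / (1 - w z)^k`. The kernel thus embeds in a space of dimension `k`. Its
dimension is `k` iff every such `p` occurs, and this holds iff `p = 1` occurs, since `H²` is stable
under multiplication by `z`. This is `rank_ker_opA_sub_pow_eq_iff`.

That `F` lies in `H²` follows from `|a|² + |b|² ≤ 1` inside the disk: it gives `|F|² ≤ Re ((1 + conj
λ b) / (1 - conj λ b))`, a harmonic majorant, whose circle means all equal its value at `0`. -/

/-! ### Bounds from radial boundary values -/

/-- A bounded holomorphic function on the disk whose radial limits are bounded by `N` almost
everywhere is bounded by `N`. -/
theorem norm_le_of_radial_limit_norm_le {g : ℂ → ℂ} {C N : ℝ}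
    (hg : DifferentiableOn ℂ g (Metric.ball 0 1)) (hC : ∀ z ∈ Metric.ball (0 : ℂ) 1, ‖g z‖ ≤ C)
    (hN : ∀ᵐ θ : ℝ, θ ∈ Set.Ioc 0 (2 * Real.pi) →
      ∃ w, HasRadialLimit g (Circle.exp θ) w ∧ ‖w‖ ≤ N)
    {z : ℂ} (hz : z ∈ Metric.ball (0 : ℂ) 1) : ‖g z‖ ≤ N := by
  classical
  have hpi : (0 : ℝ) ≤ 2 * Real.pi := Real.two_pi_pos.le
  have hzn : ‖z‖ < 1 := by simpa using hz
  have hmem : ∀ r : ℝ, r ∈ Set.Ioo (0 : ℝ) 1 → ∀ ζ : ℂ, ‖ζ‖ ≤ 1 →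
      (r : ℂ) * ζ ∈ Metric.ball (0 : ℂ) 1 := by
    intro r hr ζ hζ
    rw [mem_ball_zero_iff, norm_mul, Complex.norm_real, Real.norm_of_nonneg hr.1.le]
    calc r * ‖ζ‖ ≤ r * 1 := by gcongr; exact hr.1.le
      _ < 1 := by linarith [hr.2]
  have hev : ∀ᶠ r : ℝ in 𝓝[<] 1, r ∈ Set.Ioo (0 : ℝ) 1 := Ioo_mem_nhdsLT one_pos
  have hcirc : ∀ θ : ℝ, ‖circleMap 0 1 θ‖ = 1 := by intro θ; simp
  have hden : ∀ θ : ℝ, ‖(circleMap 0 1 θ - 0) - (z - 0)‖ ≠ 0 := by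
    intro θ h
    rw [norm_eq_zero, sub_zero, sub_zero, sub_eq_zero] at h
    have := hcirc θ
    rw [h] at this
    linarith
  have hPc : Continuous fun θ : ℝ => poissonKernel 0 z (circleMap 0 1 θ) := by
    unfold poissonKernel
    refine Continuous.div (by fun_prop) (by fun_prop) fun θ => pow_ne_zero 2 (hden θ)
  have hP0 : ∀ θ : ℝ, 0 ≤ poissonKernel 0 z (circleMap 0 1 θ) := by
    intro θ
    unfold poissonKernel
    refine div_nonneg ?_ (by positivity)
    simp only [sub_zero, hcirc]
    nlinarith [norm_nonneg z]
  have hgc : ∀ r ∈ Set.Ioo (0 : ℝ) 1, Continuous fun θ : ℝ => g (r * circleMap 0 1 θ) := by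
    intro r hr
    exact hg.continuousOn.comp_continuous (by fun_prop)
      fun θ => hmem r hr _ (hcirc θ).le
  have hpois : ∀ f : ℂ → ℂ, DifferentiableOn ℂ f (Metric.closedBall 0 1) →
      (2 * Real.pi)⁻¹ • ∫ θ in 0..2 * Real.pi,
        poissonKernel 0 z (circleMap 0 1 θ) • f (circleMap 0 1 θ) = f z := by
    intro f hf
    exact DiffContOnCl.circleAverage_poissonKernel_smul
      (hf.mono Metric.closure_ball_subset_closedBall).diffContOnCl hz
  have hone : (2 * Real.pi)⁻¹ * ∫ θ in 0..2 * Real.pi,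
      poissonKernel 0 z (circleMap 0 1 θ) = 1 := by
    have := hpois (fun _ => 1) (by fun_prop)
    have h2 := congrArg Complex.re this
    simp only [Complex.real_smul, mul_one] at h2
    rw [intervalIntegral.integral_ofReal] at h2
    rw [← Complex.ofReal_mul] at h2
    simpa using h2
  -- On the period, the default `0` is used only on a null set. Measurability of `gs` is never
  -- needed: dominated convergence asks it of the approximants only.
  set gs : ℝ → ℂ := fun θ => if h : ∃ w, HasRadialLimit g (Circle.exp θ) w ∧ ‖w‖ ≤ N
    then h.choose else 0 with hgs
  have hgs1 : ∀ᵐ θ : ℝ, θ ∈ Set.Ioc 0 (2 * Real.pi) →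
      HasRadialLimit g (Circle.exp θ) (gs θ) ∧ ‖gs θ‖ ≤ N := by
    filter_upwards [hN] with θ hθ hθ2
    have h := hθ hθ2
    simp only [hgs, dif_pos h]
    exact h.choose_spec
  have hlim1 : Tendsto (fun r : ℝ => g (r * z)) (𝓝[<] 1) (𝓝 (g z)) := by
    have h1 : ContinuousAt g z := hg.continuousOn.continuousAt (Metric.isOpen_ball.mem_nhds hz)
    have h2 : Tendsto (fun r : ℝ => (r : ℂ) * z) (𝓝[<] 1) (𝓝 z) := by
      have : Continuous fun r : ℝ => (r : ℂ) * z := by fun_prop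
      have := this.tendsto 1
      simp only [Complex.ofReal_one, one_mul] at this
      exact this.mono_left nhdsWithin_le_nhds
    exact h1.tendsto.comp h2
  have hlim2 : Tendsto (fun r : ℝ => ∫ θ in 0..2 * Real.pi,
      poissonKernel 0 z (circleMap 0 1 θ) • g (r * circleMap 0 1 θ)) (𝓝[<] 1)
      (𝓝 (∫ θ in 0..2 * Real.pi, poissonKernel 0 z (circleMap 0 1 θ) • gs θ)) := by
    refine intervalIntegral.tendsto_integral_filter_of_dominated_convergence
      (fun θ => poissonKernel 0 z (circleMap 0 1 θ) * C) ?_ ?_ ?_ ?_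
    · filter_upwards [hev] with r hr
      exact (hPc.smul (hgc r hr)).aestronglyMeasurable
    · filter_upwards [hev] with r hr
      refine ae_of_all _ fun θ _ => ?_
      rw [norm_smul, Real.norm_of_nonneg (hP0 θ)]
      exact mul_le_mul_of_nonneg_left (hC _ (hmem r hr _ (hcirc θ).le)) (hP0 θ)
    · exact (hPc.mul continuous_const).intervalIntegrable _ _
    · filter_upwards [hgs1] with θ hθ hθ2
      rw [Set.uIoc_of_le hpi] at hθ2
      have := (hθ hθ2).1
      unfold HasRadialLimit at this
      refine tendsto_const_nhds.smul ?_
      simpa [circleMap, Circle.coe_exp] using this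
  -- The dilates `g (r ·)` satisfy the Poisson formula on the closed disk; letting `r → 1`
  -- represents `g z` by its boundary values.
  have heq : g z = (2 * Real.pi)⁻¹ • ∫ θ in 0..2 * Real.pi,
      poissonKernel 0 z (circleMap 0 1 θ) • gs θ := by
    refine tendsto_nhds_unique hlim1 ((hlim2.const_smul (2 * Real.pi)⁻¹).congr' ?_)
    filter_upwards [hev] with r hr
    refine hpois (fun x => g (r * x)) (hg.comp (by fun_prop) ?_)
    intro x hx
    exact hmem r hr x (by simpa using hx)
  rw [heq, norm_smul, Real.norm_of_nonneg (by positivity)]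
  calc (2 * Real.pi)⁻¹ * ‖∫ θ in 0..2 * Real.pi, poissonKernel 0 z (circleMap 0 1 θ) • gs θ‖
      ≤ (2 * Real.pi)⁻¹ * ∫ θ in 0..2 * Real.pi, poissonKernel 0 z (circleMap 0 1 θ) * N := by
        gcongr
        refine intervalIntegral.norm_integral_le_of_norm_le hpi ?_
          ((hPc.mul continuous_const).intervalIntegrable _ _)
        filter_upwards [hgs1] with θ hθ hθ2
        rw [norm_smul, Real.norm_of_nonneg (hP0 θ)]
        exact mul_le_mul_of_nonneg_left (hθ hθ2).2 (hP0 θ)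
    _ = N := by
        rw [intervalIntegral.integral_mul_const, ← mul_assoc, hone, one_mul]

theorem ae_Ioc_of_ae_circleLebesgue {p : Circle → Prop} (h : ∀ᵐ ζ ∂circleLebesgue, p ζ) :
    ∀ᵐ θ : ℝ, θ ∈ Set.Ioc 0 (2 * Real.pi) → p (Circle.exp θ) := by
  have hc : (ENNReal.ofReal (2 * Real.pi))⁻¹ ≠ 0 := ENNReal.inv_ne_zero.2 ENNReal.ofReal_ne_top
  have h1 : ∀ᵐ ζ ∂Measure.map Circle.exp (volume.restrict (Set.Ioc 0 (2 * Real.pi))), p ζ := by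
    rw [circleLebesgue, Measure.ae_ennreal_smul_measure_iff hc] at h
    exact h
  have h2 := ae_of_ae_map Circle.exp.continuous.measurable.aemeasurable h1
  exact (ae_restrict_iff' measurableSet_Ioc).1 h2

/-! ### Pointwise estimates for a pair -/

namespace IsPair

variable {b a : ℂ → ℂ}

/-- Freeze `z` and consider `x ↦ conj (a z) a x + conj (b z) b x`. By Cauchy–Schwarz its boundary
values are at most `√M`, while at `x = z` it equals `M`; so `M ≤ √M`, whence `M ≤ 1`. -/
theorem norm_sq_add_norm_sq_le_one (h : IsPair b a) {z : ℂ} (hz : z ∈ Metric.ball (0 : ℂ) 1) :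
    ‖a z‖ ^ 2 + ‖b z‖ ^ 2 ≤ 1 := by
  obtain ⟨C, hC⟩ := h.bounded_a
  set M : ℝ := ‖a z‖ ^ 2 + ‖b z‖ ^ 2 with hM
  have hM0 : 0 ≤ M := by positivity
  have key : ‖conj (a z) * a z + conj (b z) * b z‖ ≤ √M := by
    refine norm_le_of_radial_limit_norm_le (g := fun x => conj (a z) * a x + conj (b z) * b x)
      (C := ‖a z‖ * C + ‖b z‖ * 1)
      ((h.differentiableOn_a.const_mul _).add (h.differentiableOn_b.const_mul _)) ?_ ?_ hz
    · intro x hx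
      refine (norm_add_le _ _).trans ?_
      rw [norm_mul, norm_mul, RCLike.norm_conj, RCLike.norm_conj]
      exact add_le_add (mul_le_mul_of_nonneg_left (hC x hx) (norm_nonneg _))
        (mul_le_mul_of_nonneg_left (h.norm_b_le x hx) (norm_nonneg _))
    · filter_upwards [ae_Ioc_of_ae_circleLebesgue h.sq_add_sq] with θ hθ hθ2
      obtain ⟨α, β, hα, hβ, hs⟩ := hθ hθ2
      refine ⟨conj (a z) * α + conj (b z) * β, (hα.const_mul _).add (hβ.const_mul _), ?_⟩
      refine Real.le_sqrt_of_sq_le ?_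
      have h1 : ‖conj (a z) * α + conj (b z) * β‖ ≤ ‖a z‖ * ‖α‖ + ‖b z‖ * ‖β‖ := by
        refine (norm_add_le _ _).trans_eq ?_
        rw [norm_mul, norm_mul, RCLike.norm_conj, RCLike.norm_conj]
      calc ‖conj (a z) * α + conj (b z) * β‖ ^ 2 ≤ (‖a z‖ * ‖α‖ + ‖b z‖ * ‖β‖) ^ 2 := by gcongr
        _ ≤ M * (‖α‖ ^ 2 + ‖β‖ ^ 2) := by
          rw [hM]; nlinarith [sq_nonneg (‖a z‖ * ‖β‖ - ‖b z‖ * ‖α‖)]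
        _ = M := by rw [hs, mul_one]
  have hval : conj (a z) * a z + conj (b z) * b z = (M : ℂ) := by
    rw [RCLike.conj_mul, RCLike.conj_mul, hM]; push_cast; rfl
  rw [hval, Complex.norm_real, Real.norm_of_nonneg hM0] at key
  have h3 : √M ^ 2 = M := Real.sq_sqrt hM0
  have h4 := Real.sqrt_nonneg M
  nlinarith

theorem a_ne_zero (h : IsPair b a) {z : ℂ} (hz : z ∈ Metric.ball (0 : ℂ) 1) : a z ≠ 0 := by
  obtain ⟨c, u, -, hu⟩ := h.outer_a
  rw [hu z hz]
  exact mul_ne_zero (Circle.coe_ne_zero c) (Complex.exp_ne_zero _)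

theorem norm_b_lt_one (h : IsPair b a) {z : ℂ} (hz : z ∈ Metric.ball (0 : ℂ) 1) :
    ‖b z‖ < 1 := by
  have h1 := h.norm_sq_add_norm_sq_le_one hz
  have h2 : 0 < ‖a z‖ := norm_pos_iff.2 (h.a_ne_zero hz)
  nlinarith [norm_nonneg (b z)]

theorem one_sub_conj_mul_ne_zero (h : IsPair b a) (lam : Circle) {z : ℂ}
    (hz : z ∈ Metric.ball (0 : ℂ) 1) : 1 - conj (lam : ℂ) * b z ≠ 0 := by
  intro h0
  have h1 : ‖conj (lam : ℂ) * b z‖ = 1 := by rw [← sub_eq_zero.1 h0, norm_one]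
  rw [norm_mul, RCLike.norm_conj, Circle.norm_coe, one_mul] at h1
  exact (h.norm_b_lt_one hz).ne h1

theorem differentiableOn_clarkF (h : IsPair b a) (lam : Circle) :
    DifferentiableOn ℂ (clarkF b a lam) (Metric.ball 0 1) :=
  h.differentiableOn_a.div ((differentiableOn_const 1).sub (h.differentiableOn_b.const_mul _))
    fun _ hz => h.one_sub_conj_mul_ne_zero lam hz

theorem clarkF_ne_zero (h : IsPair b a) (lam : Circle) {z : ℂ}
    (hz : z ∈ Metric.ball (0 : ℂ) 1) : clarkF b a lam z ≠ 0 :=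
  div_ne_zero (h.a_ne_zero hz) (h.one_sub_conj_mul_ne_zero lam hz)

theorem norm_clarkF_sq_le (h : IsPair b a) (lam : Circle) {z : ℂ}
    (hz : z ∈ Metric.ball (0 : ℂ) 1) :
    ‖clarkF b a lam z‖ ^ 2 ≤
      ((1 + conj (lam : ℂ) * b z) / (1 - conj (lam : ℂ) * b z)).re := by
  have hb : ‖conj (lam : ℂ) * b z‖ = ‖b z‖ := by
    rw [norm_mul, RCLike.norm_conj, Circle.norm_coe, one_mul]
  have hre : ((1 + conj (lam : ℂ) * b z) / (1 - conj (lam : ℂ) * b z)).re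
      = (1 - ‖b z‖ ^ 2) / ‖1 - conj (lam : ℂ) * b z‖ ^ 2 := by
    -- The Herglotz and Poisson kernels at the boundary point `1`, with `conj λ * b z` as the
    -- interior point.
    have := congrFun (poissonKernel_eq_re_herglotzRieszKernel (c := 0)
      (w := conj (lam : ℂ) * b z)) 1
    simpa only [poissonKernel, herglotzRieszKernel, Function.comp_apply, sub_zero, norm_one,
      one_pow, hb] using this.symm
  rw [hre, clarkF, norm_div, div_pow]
  gcongr
  linarith [h.norm_sq_add_norm_sq_le_one hz]

end IsPair

/-! ### Membership in `H²` from a harmonic majorant -/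

/-- **Bessel's inequality** for the Taylor coefficients of a holomorphic function on the disk. -/
theorem sum_norm_taylorCoeff_sq_le {f : ℂ → ℂ} (hf : DifferentiableOn ℂ f (Metric.ball 0 1))
    {r : ℝ} (hr : r ∈ Set.Ioo (0 : ℝ) 1) (s : Finset ℕ) :
    ∑ n ∈ s, ‖(n.factorial : ℂ)⁻¹ * iteratedDeriv n f 0‖ ^ 2 * r ^ (2 * n) ≤
      Real.circleAverage (fun z => ‖f z‖ ^ 2) 0 r := by
  have hsub : Metric.closedBall (0 : ℂ) r ⊆ Metric.ball 0 1 := Metric.closedBall_subset_ball hr.2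
  have hc : Continuous fun θ : ℝ => f (circleMap 0 r θ) :=
    hf.continuousOn.comp_continuous (by fun_prop)
      fun θ => hsub (circleMap_mem_closedBall 0 hr.1.le θ)
  have hL2 : MemLp (fun θ : ℝ => f (circleMap 0 r θ)) 2
      (volume.restrict (Set.Ioc 0 (2 * Real.pi))) := by
    obtain ⟨K, hK⟩ := (isCompact_Icc (a := (0 : ℝ)) (b := 2 * Real.pi)).exists_bound_of_continuousOn
      hc.continuousOn
    refine MemLp.of_bound hc.aestronglyMeasurable K ?_
    filter_upwards [ae_restrict_mem measurableSet_Ioc] with θ hθ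
    exact hK θ ⟨hθ.1.le, hθ.2⟩
  have hsum := hasSum_sq_fourierCoeffOn Real.two_pi_pos hL2
  -- Cauchy's formula identifies the Fourier coefficients of nonnegative index on the circle of
  -- radius `r`; Parseval restricted to these indices gives the bound.
  have hcoeff : ∀ n : ℕ, fourierCoeffOn Real.two_pi_pos (fun θ : ℝ => f (circleMap 0 r θ)) n
      = ((n.factorial : ℂ)⁻¹ * iteratedDeriv n f 0) * r ^ n := by
    intro n
    have hci := DifferentiableOn.circleIntegral_one_div_sub_center_pow_smul hr.1 n (hf.mono hsub)
    rw [circleIntegral] at hci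
    have hr0 : (r : ℂ) ≠ 0 := by exact_mod_cast hr.1.ne'
    have hint : ∀ θ : ℝ, (fourier (-(n : ℤ)) (θ : AddCircle (2 * Real.pi - 0))) •
        f (circleMap 0 r θ) = ((r : ℂ) ^ n * Complex.I⁻¹) * (deriv (circleMap 0 r) θ •
          (1 / (circleMap 0 r θ - 0) ^ (n + 1)) • f (circleMap 0 r θ)) := by
      intro θ
      have h1 : (fourier (-(n : ℤ)) (θ : AddCircle (2 * Real.pi - 0)))
          = (Complex.exp (θ * Complex.I) ^ n)⁻¹ := by
        rw [fourier_coe_apply, ← Complex.exp_nat_mul, ← Complex.exp_neg]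
        congr 1
        have : (Real.pi : ℂ) ≠ 0 := by exact_mod_cast Real.pi_ne_zero
        push_cast
        field_simp
        ring
      rw [h1]
      simp only [deriv_circleMap, smul_eq_mul, circleMap, zero_add, sub_zero]
      have he := Complex.exp_ne_zero (θ * Complex.I)
      have hI := Complex.I_ne_zero
      field_simp
      ring
    rw [fourierCoeffOn_eq_integral]
    simp_rw [hint]
    rw [intervalIntegral.integral_const_mul, hci]
    have : (Real.pi : ℂ) ≠ 0 := by exact_mod_cast Real.pi_ne_zero
    have hI := Complex.I_ne_zero
    have hn : (n.factorial : ℂ) ≠ 0 := by exact_mod_cast n.factorial_ne_zero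
    simp only [smul_eq_mul, Complex.real_smul]
    push_cast
    field_simp
    ring
  have hle := (sum_le_hasSum (s.map Nat.castEmbedding) (fun _ _ => sq_nonneg _) hsum)
  rw [Finset.sum_map] at hle
  simp only [Nat.castEmbedding_apply, hcoeff, sub_zero] at hle
  rw [Real.circleAverage_def]
  refine le_trans (le_of_eq ?_) hle
  refine Finset.sum_congr rfl fun n _ => ?_
  rw [norm_mul _ ((r : ℂ) ^ n), mul_pow, norm_pow, Complex.norm_real, Real.norm_of_nonneg hr.1.le, ← pow_mul,
    mul_comm n 2]

/-- A holomorphic function on the disk for which `‖f‖ ^ 2` is dominated by the real part of a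
holomorphic function belongs to `H²`. -/
theorem memHardyTwo_of_norm_sq_le_re {f G : ℂ → ℂ}
    (hf : DifferentiableOn ℂ f (Metric.ball 0 1)) (hG : DifferentiableOn ℂ G (Metric.ball 0 1))
    (hfG : ∀ z ∈ Metric.ball (0 : ℂ) 1, ‖f z‖ ^ 2 ≤ (G z).re) : MemHardyTwo f := by
  have hbd : ∀ r ∈ Set.Ioo (0 : ℝ) 1, ∀ s : Finset ℕ,
      ∑ n ∈ s, ‖(n.factorial : ℂ)⁻¹ * iteratedDeriv n f 0‖ ^ 2 * r ^ (2 * n) ≤ (G 0).re := by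
    intro r hr s
    refine (sum_norm_taylorCoeff_sq_le hf hr s).trans ?_
    have hr' : |r| = r := abs_of_pos hr.1
    have hsub : Metric.closedBall (0 : ℂ) |r| ⊆ Metric.ball 0 1 :=
      Metric.closedBall_subset_ball (hr'.trans_lt hr.2)
    have hsph : Metric.sphere (0 : ℂ) |r| ⊆ Metric.ball 0 1 :=
      Metric.sphere_subset_closedBall.trans hsub
    have hGi : CircleIntegrable G 0 r := ContinuousOn.circleIntegrable' (hG.continuousOn.mono hsph)
    -- The mean value property makes the bound independent of `r`.
    have hmean : Real.circleAverage (fun z => (G z).re) 0 r = (G 0).re := by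
      have h1 := Complex.reCLM.circleAverage_comp_comm hGi
      have h2 : Real.circleAverage G 0 r = G 0 := DiffContOnCl.circleAverage
        ((hG.mono hsub).mono Metric.closure_ball_subset_closedBall).diffContOnCl
      rw [h2] at h1
      exact h1
    rw [← hmean]
    refine Real.circleAverage_mono
      (ContinuousOn.circleIntegrable' ((hf.continuousOn.mono hsph).norm.pow 2))
      (ContinuousOn.circleIntegrable'
        (Complex.continuous_re.comp_continuousOn (hG.continuousOn.mono hsph)))
      fun z hz => hfG z (hsph hz)
  have hbd1 : ∀ s : Finset ℕ,
      ∑ n ∈ s, ‖(n.factorial : ℂ)⁻¹ * iteratedDeriv n f 0‖ ^ 2 ≤ (G 0).re := by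
    intro s
    have hlim : Tendsto (fun r : ℝ =>
        ∑ n ∈ s, ‖(n.factorial : ℂ)⁻¹ * iteratedDeriv n f 0‖ ^ 2 * r ^ (2 * n)) (𝓝[<] 1)
        (𝓝 (∑ n ∈ s, ‖(n.factorial : ℂ)⁻¹ * iteratedDeriv n f 0‖ ^ 2)) := by
      have : Continuous fun r : ℝ =>
        ∑ n ∈ s, ‖(n.factorial : ℂ)⁻¹ * iteratedDeriv n f 0‖ ^ 2 * r ^ (2 * n) := by fun_prop
      have := this.tendsto 1
      simp only [one_pow, mul_one] at this
      exact this.mono_left nhdsWithin_le_nhds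
    refine le_of_tendsto hlim ?_
    filter_upwards [Ioo_mem_nhdsLT (one_pos (α := ℝ))] with r hr using hbd r hr s
  have hmem : Memℓp (E := fun _ : ℕ => ℂ)
      (fun n => (n.factorial : ℂ)⁻¹ * iteratedDeriv n f 0) 2 := by
    refine memℓp_gen ?_
    simpa using summable_of_sum_le (fun _ => sq_nonneg _) hbd1
  refine ⟨⟨_, hmem⟩, fun z hz => ?_⟩
  have := Complex.taylorSeries_eq_on_ball' hz hf
  simp only [sub_zero] at this
  exact this

theorem IsPair.memHardyTwo_clarkF {b a : ℂ → ℂ} (h : IsPair b a) (lam : Circle) :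
    MemHardyTwo (clarkF b a lam) := by
  have hb := h.differentiableOn_b.const_mul (conj (lam : ℂ))
  exact memHardyTwo_of_norm_sq_le_re (h.differentiableOn_clarkF lam)
    (((differentiableOn_const 1).add hb).div ((differentiableOn_const 1).sub hb)
      fun z hz => h.one_sub_conj_mul_ne_zero lam hz)
    fun z hz => h.norm_clarkF_sq_le lam hz

/-! ### Coefficients and values of elements of `H²` -/

namespace HardyTwo

theorem shift_single (n : ℕ) : shift (lp.single 2 n 1) = lp.single 2 (n + 1) 1 := by
  ext m
  cases m with
  | zero => rw [shift_apply_zero, lp.single_apply_ne _ _ _ (Nat.succ_ne_zero n).symm]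
  | succ m =>
    rw [shift_apply_succ]
    by_cases h : m = n
    · subst h; rw [lp.single_apply_self, lp.single_apply_self]
    · rw [lp.single_apply_ne _ _ _ h, lp.single_apply_ne _ _ _ (by omega)]

theorem backwardShift_apply (f : HardyTwo) (n : ℕ) : backwardShift f n = f (n + 1) := by
  have h := ContinuousLinearMap.adjoint_inner_right shift (lp.single 2 n (1 : ℂ)) f
  rw [shift_single, lp.inner_single_left, lp.inner_single_left] at h
  simpa [backwardShift] using h

theorem eval_zero (f : HardyTwo) : f.eval 0 = f 0 := by
  rw [eval, tsum_eq_single 0 fun n hn => by simp [hn]]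
  simp

theorem opA_apply (F f : HardyTwo) (n : ℕ) :
    opA F f n = f (n + 1) - (F 0)⁻¹ * f 0 * F (n + 1) := by
  have h1 : inner ℂ one f = f 0 := by
    rw [one, lp.inner_single_left]; simp
  rw [opA, sub_apply, smul_apply,
    InnerProductSpace.rankOne_apply, h1, eval_zero, lp.coeFn_sub, lp.coeFn_smul, lp.coeFn_smul,
    Pi.sub_apply, Pi.smul_apply, Pi.smul_apply, backwardShift_apply, backwardShift_apply,
    smul_eq_mul, smul_eq_mul, mul_assoc]

theorem summable_eval (f : HardyTwo) {z : ℂ} (hz : z ∈ Metric.ball (0 : ℂ) 1) :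
    Summable fun n => f n * z ^ n := by
  rw [mem_ball_zero_iff] at hz
  refine Summable.of_norm_bounded
    ((summable_geometric_of_lt_one (norm_nonneg z) hz).mul_left ‖f‖) fun n => ?_
  rw [norm_mul, norm_pow]
  gcongr
  exact lp.norm_apply_le_norm (by norm_num) f n

theorem eval_shift (f : HardyTwo) {z : ℂ} (hz : z ∈ Metric.ball (0 : ℂ) 1) :
    (shift f).eval z = z * f.eval z := by
  rw [eval, (summable_eval _ hz).tsum_eq_zero_add, eval, ← tsum_mul_left]
  simp only [shift_apply_zero, shift_apply_succ, zero_mul, zero_add]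
  exact tsum_congr fun n => by ring

theorem eval_sub (f g : HardyTwo) {z : ℂ} (hz : z ∈ Metric.ball (0 : ℂ) 1) :
    (f - g).eval z = f.eval z - g.eval z := by
  rw [eval, eval, eval, ← (summable_eval f hz).tsum_sub (summable_eval g hz)]
  exact tsum_congr fun n => by rw [lp.coeFn_sub, Pi.sub_apply, sub_mul]

theorem eval_smul (c : ℂ) (f : HardyTwo) (z : ℂ) : (c • f).eval z = c * f.eval z := by
  rw [eval, eval, ← tsum_mul_left]
  exact tsum_congr fun n => by rw [lp.coeFn_smul, Pi.smul_apply, smul_eq_mul, mul_assoc]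

theorem hasFPowerSeriesAt_eval (f : HardyTwo) :
    HasFPowerSeriesAt f.eval (FormalMultilinearSeries.ofScalars ℂ (f : ℕ → ℂ)) 0 := by
  rw [hasFPowerSeriesAt_iff]
  filter_upwards [Metric.ball_mem_nhds (0 : ℂ) one_pos] with z hz
  have := (summable_eval f hz).hasSum
  simpa [eval, FormalMultilinearSeries.coeff_ofScalars, mul_comm] using this

theorem eq_of_eval_eq {f g : HardyTwo}
    (h : ∀ z ∈ Metric.ball (0 : ℂ) 1, f.eval z = g.eval z) : f = g := by
  have h1 : f.eval =ᶠ[𝓝 0] g.eval := by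
    filter_upwards [Metric.ball_mem_nhds (0 : ℂ) one_pos] with z hz using h z hz
  have h2 := (hasFPowerSeriesAt_eval f).eq_formalMultilinearSeries_of_eventually
    (hasFPowerSeriesAt_eval g) h1
  ext n
  have h3 := congrArg (fun p => FormalMultilinearSeries.coeff p n) h2
  simpa [FormalMultilinearSeries.coeff_ofScalars] using h3

/-! ### Passage to formal power series -/

/-- The Taylor series of an element of `H²`. -/
noncomputable def toPowerSeries : HardyTwo →ₗ[ℂ] PowerSeries ℂ where
  toFun f := PowerSeries.mk f
  map_add' f g := by ext n; simp only [PowerSeries.coeff_mk, map_add]; rfl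
  map_smul' c f := by ext n; simp only [PowerSeries.coeff_mk, map_smul]; rfl

@[simp]
theorem coeff_toPowerSeries (f : HardyTwo) (n : ℕ) : PowerSeries.coeff n (toPowerSeries f) = f n :=
  PowerSeries.coeff_mk _ _

theorem toPowerSeries_injective : Function.Injective toPowerSeries := by
  intro f g h
  ext n
  simpa using congrArg (PowerSeries.coeff n) h

theorem toPowerSeries_shift (f : HardyTwo) :
    toPowerSeries (shift f) = PowerSeries.X * toPowerSeries f := by
  ext n
  cases n with
  | zero => simp [shift_apply_zero]
  | succ n => rw [PowerSeries.coeff_succ_X_mul, coeff_toPowerSeries, coeff_toPowerSeries,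
      shift_apply_succ]

/-- Multiplication by `1 - w * z` on `H²`. -/
noncomputable def mulOneSub (w : ℂ) : HardyTwo →L[ℂ] HardyTwo := ContinuousLinearMap.id ℂ HardyTwo - w • shift

theorem mulOneSub_apply (w : ℂ) (f : HardyTwo) : mulOneSub w f = f - w • shift f := rfl

theorem toPowerSeries_mulOneSub_pow (w : ℂ) (k : ℕ) (f : HardyTwo) :
    toPowerSeries ((mulOneSub w ^ k) f) =
      (1 - PowerSeries.C w * PowerSeries.X) ^ k * toPowerSeries f := by
  induction k with
  | zero => simp
  | succ k ih =>
    rw [pow_succ', mul_apply_eq_comp, mulOneSub_apply, map_sub, map_smul,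
      toPowerSeries_shift, ih, PowerSeries.smul_eq_C_mul]
    ring

theorem eval_mulOneSub_pow (w : ℂ) (k : ℕ) (f : HardyTwo) {z : ℂ}
    (hz : z ∈ Metric.ball (0 : ℂ) 1) :
    ((mulOneSub w ^ k) f).eval z = (1 - w * z) ^ k * f.eval z := by
  induction k with
  | zero => simp
  | succ k ih =>
    rw [pow_succ', mul_apply_eq_comp, mulOneSub_apply, eval_sub _ _ hz, eval_smul,
      eval_shift _ hz, ih]
    ring

/-! ### Division by `F` and the kernel of `(opA F - w) ^ k` -/

/-- The power series quotient `f / F`. -/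
noncomputable def quotientSeries (F : HardyTwo) : HardyTwo →ₗ[ℂ] PowerSeries ℂ :=
  LinearMap.mulLeft ℂ (toPowerSeries F)⁻¹ ∘ₗ toPowerSeries

theorem quotientSeries_apply (F f : HardyTwo) :
    quotientSeries F f = (toPowerSeries F)⁻¹ * toPowerSeries f := rfl

variable {F : HardyTwo}

theorem constantCoeff_toPowerSeries_ne_zero (hF : F 0 ≠ 0) :
    PowerSeries.constantCoeff (toPowerSeries F) ≠ 0 := by
  rwa [← PowerSeries.coeff_zero_eq_constantCoeff_apply, coeff_toPowerSeries]

theorem quotientSeries_injective (hF : F 0 ≠ 0) : Function.Injective (quotientSeries F) := by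
  intro f g h
  have h1 := congrArg (toPowerSeries F * ·) h
  simp only [quotientSeries_apply, ← mul_assoc,
    PowerSeries.mul_inv_cancel _ (constantCoeff_toPowerSeries_ne_zero hF), one_mul] at h1
  exact toPowerSeries_injective h1

/-- On the quotients by `F`, the operator `opA F` acts as the backward shift. -/
theorem coeff_quotientSeries_opA (hF : F 0 ≠ 0) (f : HardyTwo) (n : ℕ) :
    PowerSeries.coeff n (quotientSeries F (opA F f)) =
      PowerSeries.coeff (n + 1) (quotientSeries F f) := by
  have h1 : PowerSeries.X * toPowerSeries (opA F f) =
      toPowerSeries f - PowerSeries.C ((F 0)⁻¹ * f 0) * toPowerSeries F := by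
    ext m
    cases m with
    | zero =>
      simp only [PowerSeries.coeff_zero_X_mul, map_sub, PowerSeries.coeff_C_mul,
        coeff_toPowerSeries]
      field_simp
      ring
    | succ m =>
      rw [PowerSeries.coeff_succ_X_mul, map_sub, PowerSeries.coeff_C_mul, coeff_toPowerSeries,
        coeff_toPowerSeries, coeff_toPowerSeries, opA_apply]
  have h2 : PowerSeries.X * quotientSeries F (opA F f) =
      quotientSeries F f - PowerSeries.C ((F 0)⁻¹ * f 0) := by
    rw [quotientSeries_apply, mul_left_comm, h1, quotientSeries_apply, mul_sub, mul_left_comm _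
      (PowerSeries.C _), PowerSeries.inv_mul_cancel _ (constantCoeff_toPowerSeries_ne_zero hF),
      mul_one]
  rw [← PowerSeries.coeff_succ_X_mul, h2, map_sub, PowerSeries.coeff_C,
    if_neg (Nat.succ_ne_zero n), sub_zero]

/-- For the backward shift, `q (n + 1) - w * q n` is the coefficient of index `n + 1` of `(1 - w X)
q`; each factor raises the index by one. -/
theorem coeff_quotientSeries_opA_sub_pow (hF : F 0 ≠ 0) (w : ℂ) (k n : ℕ) (f : HardyTwo) :
    PowerSeries.coeff n
        (quotientSeries F (((opA F - w • ContinuousLinearMap.id ℂ HardyTwo) ^ k) f)) =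
      PowerSeries.coeff (n + k)
        ((1 - PowerSeries.C w * PowerSeries.X) ^ k * quotientSeries F f) := by
  induction k generalizing n with
  | zero => simp
  | succ k ih =>
    rw [pow_succ', mul_apply_eq_comp, sub_apply, map_sub, map_sub,
      coeff_quotientSeries_opA hF, ih, smul_apply, ContinuousLinearMap.id_apply,
      map_smul, map_smul, ih, pow_succ', mul_assoc, sub_mul, one_mul, mul_assoc (PowerSeries.C w),
      map_sub, PowerSeries.coeff_C_mul, ← add_assoc n k 1, PowerSeries.coeff_succ_X_mul,
      smul_eq_mul, add_right_comm]

/-- The kernel of `(opA F - w) ^ k` has dimension `k` if and only if `F / (1 - w * z) ^ k` belongs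
to `H²`. -/
theorem rank_ker_opA_sub_pow_eq_iff (hF : F 0 ≠ 0) (w : ℂ) (k : ℕ) :
    Module.rank ℂ
        (LinearMap.ker (((opA F - w • ContinuousLinearMap.id ℂ HardyTwo) ^ k :
          HardyTwo →L[ℂ] HardyTwo) : HardyTwo →ₗ[ℂ] HardyTwo)) = (k : Cardinal) ↔
      ∃ h : HardyTwo, (mulOneSub w ^ k) h = F := by
  set K := LinearMap.ker (((opA F - w • ContinuousLinearMap.id ℂ HardyTwo) ^ k :
          HardyTwo →L[ℂ] HardyTwo) : HardyTwo →ₗ[ℂ] HardyTwo) with hK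
  -- Membership in `K` says that `(1 - w X)^k f / F` is a polynomial of degree less than `k`; `L`
  -- below records its coefficients.
  have hmem : ∀ f : HardyTwo, f ∈ K ↔ ∀ n, PowerSeries.coeff (n + k)
      ((1 - PowerSeries.C w * PowerSeries.X) ^ k * quotientSeries F f) = 0 := by
    intro f
    rw [hK, LinearMap.mem_ker, ContinuousLinearMap.coe_coe,
      ← map_eq_zero_iff _ (quotientSeries_injective hF), PowerSeries.ext_iff]
    refine forall_congr' fun n => ?_
    rw [coeff_quotientSeries_opA_sub_pow hF, map_zero]
  have hu : (1 - PowerSeries.C w * PowerSeries.X : PowerSeries ℂ) ^ k ≠ 0 := by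
    refine pow_ne_zero k fun h => ?_
    simpa using congrArg PowerSeries.constantCoeff h
  let L : K →ₗ[ℂ] (Fin k → ℂ) := LinearMap.pi fun i =>
    (PowerSeries.coeff (R := ℂ) i) ∘ₗ
      LinearMap.mulLeft ℂ ((1 - PowerSeries.C w * PowerSeries.X) ^ k) ∘ₗ
      quotientSeries F ∘ₗ K.subtype
  have hL : ∀ (f : K) (i : Fin k), L f i = PowerSeries.coeff (i : ℕ)
      ((1 - PowerSeries.C w * PowerSeries.X) ^ k * quotientSeries F f) := fun _ _ => rfl
  have hLinj : Function.Injective L := by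
    rw [injective_iff_map_eq_zero]
    intro f hf
    have h0 : (1 - PowerSeries.C w * PowerSeries.X) ^ k * quotientSeries F f = 0 := by
      ext n
      rw [map_zero]
      rcases lt_or_ge n k with hn | hn
      · rw [← hL f ⟨n, hn⟩, hf]; rfl
      · obtain ⟨m, rfl⟩ := Nat.exists_eq_add_of_le' hn
        exact (hmem f).1 f.2 m
    have h1 := (mul_eq_zero.1 h0).resolve_left hu
    exact Subtype.ext ((map_eq_zero_iff _ (quotientSeries_injective hF)).1 h1)
  -- The function `F / (1 - w z)^k` is the one whose polynomial is `1`.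
  have hquot : ∀ (h : HardyTwo), (mulOneSub w ^ k) h = F ↔
      (1 - PowerSeries.C w * PowerSeries.X) ^ k * quotientSeries F h = 1 := by
    intro h
    rw [← toPowerSeries_injective.eq_iff, toPowerSeries_mulOneSub_pow, quotientSeries_apply,
      mul_left_comm, mul_comm (toPowerSeries F)⁻¹]
    have hF' := constantCoeff_toPowerSeries_ne_zero hF
    constructor
    · intro h1
      rw [h1, PowerSeries.mul_inv_cancel _ hF']
    · intro h1
      have h2 := congrArg (· * toPowerSeries F) h1
      simpa only [mul_assoc, PowerSeries.inv_mul_cancel _ hF', mul_one, one_mul] using h2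
  constructor
  · intro hr
    -- For `k = 0` there is no coordinate of index `0` to prescribe, but `F` itself is a solution.
    rcases Nat.eq_zero_or_pos k with rfl | hk
    · exact ⟨F, by simp⟩
    have : FiniteDimensional ℂ K := FiniteDimensional.of_injective L hLinj
    have hfr : Module.finrank ℂ K = Module.finrank ℂ (Fin k → ℂ) := by
      rw [Module.finrank_fin_fun]
      exact Module.finrank_eq_of_rank_eq hr
    obtain ⟨f, hf⟩ := (LinearMap.injective_iff_surjective_of_finrank_eq_finrank hfr).1 hLinj
      (Pi.single ⟨0, hk⟩ 1)
    refine ⟨f, (hquot f).2 ?_⟩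
    ext n
    rw [PowerSeries.coeff_one]
    rcases lt_or_ge n k with hn | hn
    · rw [← hL f ⟨n, hn⟩, hf, Pi.single_apply]
      simp
    · obtain ⟨m, rfl⟩ := Nat.exists_eq_add_of_le' hn
      rw [(hmem f).1 f.2 m, if_neg (by omega)]
  · rintro ⟨h, hh⟩
    have h1 := (hquot h).1 hh
    -- The functions `z^i h` with `i < k` realise the monomials `X^i`, hence all of `Fin k → ℂ`.
    have hS : ∀ i : ℕ, (1 - PowerSeries.C w * PowerSeries.X) ^ k *
        quotientSeries F ((shift ^ i) h) = PowerSeries.X ^ i := by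
      intro i
      induction i with
      | zero => simpa using h1
      | succ i ih =>
        rw [pow_succ', mul_apply_eq_comp, quotientSeries_apply, toPowerSeries_shift,
          pow_succ', ← ih, quotientSeries_apply]
        ring
    have hSmem : ∀ i : Fin k, (shift ^ (i : ℕ)) h ∈ K := by
      intro i
      rw [hmem]
      intro n
      rw [hS, PowerSeries.coeff_X_pow, if_neg (by omega)]
    have hLS : ∀ i : Fin k, L ⟨_, hSmem i⟩ = Pi.single i 1 := by
      intro i
      ext j
      rw [hL, hS, PowerSeries.coeff_X_pow, Pi.single_apply]
      simp [Fin.ext_iff]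
    have hLsurj : Function.Surjective L := by
      intro v
      refine ⟨∑ i, v i • ⟨_, hSmem i⟩, ?_⟩
      rw [map_sum]
      simp_rw [map_smul, hLS]
      ext j
      simp [Pi.single_apply]
    rw [(LinearEquiv.ofBijective L ⟨hLinj, hLsurj⟩).rank_eq, rank_fin_fun]

end HardyTwo

/-! ### The equivalence for `F_λ` -/

theorem proposition3 (b a : ℂ → ℂ) (hab : IsPair b a) (z₀ lam : Circle)
    (μ : Measure Circle) (hμ : IsClarkMeasure b lam μ) (hac : μ ≪ circleLebesgue) (k : ℕ) :
    ∃ F : HardyTwo, (∀ z ∈ Metric.ball (0 : ℂ) 1, F.eval z = clarkF b a lam z) ∧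
      (Module.rank ℂ
          (LinearMap.ker (((HardyTwo.opA F - conj (z₀ : ℂ) • ContinuousLinearMap.id ℂ HardyTwo) ^ k :
            HardyTwo →L[ℂ] HardyTwo) : HardyTwo →ₗ[ℂ] HardyTwo)) = (k : Cardinal) ↔
        MemHardyTwo (fun z => clarkF b a lam z * ((1 - conj (z₀ : ℂ) * z) ^ k)⁻¹)) := by
  obtain ⟨F, hF⟩ := hab.memHardyTwo_clarkF lam
  refine ⟨F, hF, ?_⟩
  have h0 : (0 : ℂ) ∈ Metric.ball (0 : ℂ) 1 := Metric.mem_ball_self one_pos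
  have hF0 : F 0 ≠ 0 := by
    rw [← HardyTwo.eval_zero, hF 0 h0]
    exact hab.clarkF_ne_zero lam h0
  have hne : ∀ z ∈ Metric.ball (0 : ℂ) 1, (1 - conj (z₀ : ℂ) * z) ^ k ≠ 0 := by
    intro z hz
    refine pow_ne_zero k fun h => ?_
    have h1 : ‖conj (z₀ : ℂ) * z‖ = 1 := by rw [← sub_eq_zero.1 h, norm_one]
    rw [norm_mul, RCLike.norm_conj, Circle.norm_coe, one_mul] at h1
    exact (mem_ball_zero_iff.1 hz).ne h1
  -- Since `1 - conj z₀ * z` has no zero in the disk, solving `(1 - conj z₀ * z)^k h = F` in `H²` is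
  -- the same as the quotient lying in `H²`, with the same `h`.
  rw [HardyTwo.rank_ker_opA_sub_pow_eq_iff hF0]
  refine exists_congr fun h => ⟨fun hh z hz => ?_, fun hh => HardyTwo.eq_of_eval_eq fun z hz => ?_⟩
  · change h.eval z = clarkF b a lam z * ((1 - conj (z₀ : ℂ) * z) ^ k)⁻¹
    rw [← hF z hz, ← hh, HardyTwo.eval_mulOneSub_pow _ _ _ hz]
    rw [mul_comm, inv_mul_cancel_left₀ (hne z hz)]
  · rw [HardyTwo.eval_mulOneSub_pow _ _ _ hz, hh z hz, hF z hz, mul_comm, mul_assoc,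
      inv_mul_cancel₀ (hne z hz), mul_one]
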